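/- Let $X$ be a complex Banach space and let $\Omega\subseteq\mathbb{C}$ be open. For each $z\in\Omega$ let $T_z$ be a $C_0$-semigroup on $X$ with generator $A_z$, and assume that there exists $\omega\in\mathbb{R}$ such that $$\sup\{e^{-\omega t}\|T_z(t)\| : t\ge 0,\ z\in\Omega\}<\infty .$$ Assume further that, for some real $\lambda>\omega$, the function $\Omega\ni z\mapsto(\lambda-A_z)^{-1}\in\mathcal{L}(X)$ is holomorphic. (Here $\mathcal{L}(X)$ is the space of bounded linear operators on $X$ with the operator norm, and $C([0,t_1];X)$ below carries the supremum norm.) Then (a) for all $t_1>0$ and $x\in X$, the function $\Omega\ni z\mapsto T_z(\cdot)x\in C([0,t_1];X)$ is holomorphic; (b) for all $t\ge 0$, the function $\Omega\ni z\mapsto T_z(t)\in\mathcal{L}(X)$ is holomorphic. -/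

import Mathlib

open Filter Topology
open scoped NNReal

/-- A `C₀`-semigroup of bounded linear operators on the complex normed space `X`: a one-parameter
semigroup `T(t)`, `t ≥ 0`, with `T(0) = I` and with continuous orbits `t ↦ T(t)x` on `[0,∞)`. -/
structure C0Semigroup (X : Type*) [NormedAddCommGroup X] [NormedSpace ℂ X] where
  toFun : ℝ≥0 → X →L[ℂ] X
  map_zero : toFun 0 = ContinuousLinearMap.id ℂ X
  map_add : ∀ s t : ℝ≥0, toFun (s + t) = (toFun s).comp (toFun t)
  strongCont : ∀ x : X, Continuous fun t : ℝ≥0 => toFun t x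

namespace C0Semigroup

variable {X : Type*} [NormedAddCommGroup X] [NormedSpace ℂ X]

instance : CoeFun (C0Semigroup X) fun _ => ℝ≥0 → X →L[ℂ] X := ⟨C0Semigroup.toFun⟩

/-- The difference quotient `t⁻¹ (T(t)x - x)`. -/
noncomputable def diffQuot (T : C0Semigroup X) (x : X) (t : ℝ≥0) : X :=
  (((t : ℝ) : ℂ)⁻¹) • (T t x - x)

/-- `x ∈ dom(A)` and `A x = y` for the generator `A` of `T`: the limit of `t⁻¹ (T(t)x - x)` as
`t → 0`, `t > 0`, exists in norm and equals `y`. -/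
def HasGeneratorValue (T : C0Semigroup X) (x y : X) : Prop :=
  Tendsto (T.diffQuot x) (𝓝[>] (0 : ℝ≥0)) (𝓝 y)

theorem HasGeneratorValue.unique {T : C0Semigroup X} {x y y' : X}
    (h : T.HasGeneratorValue x y) (h' : T.HasGeneratorValue x y') : y = y' :=
  tendsto_nhds_unique h h'

theorem HasGeneratorValue.zero (T : C0Semigroup X) : T.HasGeneratorValue 0 0 := by
  have h : T.diffQuot 0 = fun _ => 0 := by
    funext t
    simp [diffQuot]
  rw [HasGeneratorValue, h]
  exact tendsto_const_nhds

theorem HasGeneratorValue.add {T : C0Semigroup X} {x y x' y' : X}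
    (h : T.HasGeneratorValue x y) (h' : T.HasGeneratorValue x' y') :
    T.HasGeneratorValue (x + x') (y + y') := by
  refine (Tendsto.add h h').congr fun t => ?_
  simp only [diffQuot, _root_.map_add, ← smul_add]
  congr 1
  abel

theorem HasGeneratorValue.smul {T : C0Semigroup X} {x y : X} (c : ℂ)
    (h : T.HasGeneratorValue x y) : T.HasGeneratorValue (c • x) (c • y) := by
  refine (Tendsto.const_smul h c).congr fun t => ?_
  simp only [diffQuot, map_smul, ← smul_sub]
  exact smul_comm _ _ _

/-- The (in general unbounded) generator `A` of a `C₀`-semigroup: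
`dom(A) = {x | lim_{t → 0+} t⁻¹ (T(t)x - x) exists}`, and `A x` is that limit. -/
noncomputable def generator (T : C0Semigroup X) : X →ₗ.[ℂ] X where
  domain :=
    { carrier := {x | ∃ y, T.HasGeneratorValue x y}
      zero_mem' := ⟨0, HasGeneratorValue.zero T⟩
      add_mem' := fun ⟨_, hx⟩ ⟨_, hy⟩ => ⟨_, hx.add hy⟩
      smul_mem' := fun c _ ⟨_, hx⟩ => ⟨_, hx.smul c⟩ }
  toFun :=
    { toFun := fun x => Classical.choose x.2
      map_add' := fun x y => (Classical.choose_spec (x + y).2).unique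
        ((Classical.choose_spec x.2).add (Classical.choose_spec y.2))
      map_smul' := fun c x => (Classical.choose_spec (c • x).2).unique
        ((Classical.choose_spec x.2).smul c) }

/-- The orbit `T(·)x` restricted to `[0,t₁]`, as an element of `C([0,t₁]; X)`. -/
def orbitOn (T : C0Semigroup X) (x : X) (t₁ : ℝ) : C(Set.Icc (0 : ℝ) t₁, X) where
  toFun s := T ⟨(s : ℝ), s.2.1⟩ x
  continuous_toFun := (T.strongCont x).comp (continuous_subtype_val.subtype_mk fun s => s.2.1)

end C0Semigroup

namespace LinearPMap

variable {X : Type*} [NormedAddCommGroup X] [NormedSpace ℂ X]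

/-- `R ∈ L(X)` is the inverse `(μ - A)⁻¹` of the operator `μ - A : dom(A) → X`. -/
def IsResolvent (A : X →ₗ.[ℂ] X) (μ : ℂ) (R : X →L[ℂ] X) : Prop :=
  (∀ y : X, ∃ h : R y ∈ A.domain, μ • R y - A ⟨R y, h⟩ = y) ∧
    ∀ x : A.domain, R (μ • (x : X) - A x) = x

theorem IsResolvent.unique {A : X →ₗ.[ℂ] X} {μ : ℂ} {R R' : X →L[ℂ] X}
    (h : A.IsResolvent μ R) (h' : A.IsResolvent μ R') : R = R' := by
  ext y
  obtain ⟨hy, e⟩ := h'.1 y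
  calc R y = R (μ • R' y - A ⟨R' y, hy⟩) := by rw [e]
    _ = R' y := h.2 ⟨R' y, hy⟩

open Classical in
/-- The resolvent `(μ - A)⁻¹ ∈ L(X)`, for `μ` in the resolvent set of `A`, that is, if `μ - A` has
a bounded everywhere defined inverse (and the zero operator for all other `μ`; this case does not
occur if `A` generates a semigroup with `‖T(t)‖ ≤ M exp(ω t)` and `Re μ > ω`). -/
noncomputable def resolventOp (A : X →ₗ.[ℂ] X) (μ : ℂ) : X →L[ℂ] X :=
  if h : ∃ R, A.IsResolvent μ R then Classical.choose h else 0

end LinearPMap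

/-!
The semigroups are recovered from their resolvents by explicit approximants that are holomorphic in
the parameter, uniformly bounded and pointwise convergent.

For `μ > ω` the resolvent at `μ` is the Laplace transform `x ↦ ∫₀^∞ exp(-μ s) T(s)x ds`
(`C0Semigroup.isResolvent_laplaceCLM`). By the resolvent identity, holomorphy of the resolvents at
`lam` gives holomorphy at every `μ > ω` (`LinearPMap.differentiableOn_of_isResolvent`). After the
substitution `v = exp(-s)`, the Laplace transforms at the integers `j + 1 > ω` are the moments
`∫₀¹ v ^ j • T(-log v)x dv`, so the integral of `v ^ N • T(-log v)x` against any polynomial in `v`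
is holomorphic in the parameter, where `N ≥ ω` is fixed. The normalized polynomials
`(1 - (v - a) ^ 2) ^ n` with `a = exp(-t)` are nonnegative on `[0,1]` and concentrate at `a` as
`n → ∞`; hence these means converge to `a ^ N • T(t)x` (`C0Semigroup.tendsto_landauMean`), and they
are bounded by `M ‖x‖` because `v ^ N` absorbs the exponential growth
(`C0Semigroup.norm_landauMean_le`). A bounded pointwise limit of holomorphic functions is
holomorphic (`differentiableOn_of_tendsto_of_bounded`), so `z ↦ T_z(t)x` is holomorphic for all `t`
and `x`.

Both assertions follow from this, since a bounded function is holomorphic once its compositions with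
a norming family of contractions are (`differentiableOn_of_norming`). The point evaluations are such
a family on `C([0,t₁]; X)`, and so are the evaluations at vectors of the closed unit ball on `L(X)`.
-/

/-! ### Holomorphy criteria for vector-valued functions -/

open MeasureTheory Metric in
/-- A function represented by its Cauchy integral over the boundary of a disc is holomorphic in
that disc. -/
theorem differentiableOn_ball_of_eq_cauchyIntegral {E : Type*} [NormedAddCommGroup E]
    [NormedSpace ℂ E] [CompleteSpace E] {F : ℂ → E} {c : ℂ} {r : ℝ} (hr : 0 < r)
    (hint : CircleIntegrable F c r)
    (hF : ∀ w ∈ ball c r,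
      (2 * (Real.pi : ℂ) * Complex.I)⁻¹ • (∮ ζ in C(c, r), (ζ - w)⁻¹ • F ζ) = F w) :
    DifferentiableOn ℂ F (ball c r) := by
  lift r to ℝ≥0 using hr.le
  have h := (hasFPowerSeriesOn_cauchy_integral hint (by exact_mod_cast hr)).differentiableOn
  rw [eball_coe] at h
  exact h.congr fun w hw => (hF w hw).symm

open MeasureTheory Metric in
/-- A pointwise limit of a uniformly bounded sequence of holomorphic functions is holomorphic:
dominated convergence passes to the limit in Cauchy's integral formula. -/
theorem differentiableOn_of_tendsto_of_bounded {E : Type*} [NormedAddCommGroup E]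
    [NormedSpace ℂ E] [CompleteSpace E] {Ω : Set ℂ} (hΩ : IsOpen Ω) {f : ℕ → ℂ → E} {F : ℂ → E}
    (hf : ∀ n, DifferentiableOn ℂ (f n) Ω) {C : ℝ} (hC : ∀ n, ∀ z ∈ Ω, ‖f n z‖ ≤ C)
    (hlim : ∀ z ∈ Ω, Tendsto (fun n => f n z) atTop (𝓝 (F z))) : DifferentiableOn ℂ F Ω := by
  intro c hc
  obtain ⟨r, hr, hrΩ⟩ := nhds_basis_closedBall.mem_iff.1 (hΩ.mem_nhds hc)
  have hsph : ∀ θ, circleMap c r θ ∈ Ω := fun θ =>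
    hrΩ (circleMap_mem_closedBall c hr.le θ)
  have hcont : ∀ n, Continuous fun θ => f n (circleMap c r θ) := fun n =>
    (hf n).continuousOn.comp_continuous (continuous_circleMap c r) hsph
  have hbd : ∀ z ∈ Ω, ‖F z‖ ≤ C := fun z hz =>
    le_of_tendsto (hlim z hz).norm (Eventually.of_forall fun n => hC n z hz)
  have hmeas : StronglyMeasurable fun θ => F (circleMap c r θ) :=
    stronglyMeasurable_of_tendsto atTop (fun n => (hcont n).stronglyMeasurable)
      (tendsto_pi_nhds.2 fun θ => hlim _ (hsph θ))
  have hint : CircleIntegrable F c r :=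
    (intervalIntegrable_const (c := C)).mono_fun hmeas.aestronglyMeasurable
      (Eventually.of_forall fun θ => (hbd _ (hsph θ)).trans (le_abs_self C))
  refine ((differentiableOn_ball_of_eq_cauchyIntegral hr hint fun w hw => ?_).differentiableAt
    (ball_mem_nhds c hr)).differentiableWithinAt
  have hker : Continuous fun θ => ‖(circleMap c r θ - w)⁻¹‖ := (continuous_circleMap_inv hw).norm
  have h1 : Tendsto (fun n => (2 * (Real.pi : ℂ) * Complex.I)⁻¹ •
      (∮ ζ in C(c, r), (ζ - w)⁻¹ • f n ζ)) atTop
      (𝓝 ((2 * (Real.pi : ℂ) * Complex.I)⁻¹ • (∮ ζ in C(c, r), (ζ - w)⁻¹ • F ζ))) := by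
    refine Tendsto.const_smul ?_ _
    refine intervalIntegral.tendsto_integral_filter_of_dominated_convergence
      (fun θ => ‖deriv (circleMap c r) θ‖ * (‖(circleMap c r θ - w)⁻¹‖ * C)) ?_ ?_ ?_ ?_
    · refine Eventually.of_forall fun n => Continuous.aestronglyMeasurable ?_
      simp only [deriv_circleMap]
      exact ((continuous_circleMap 0 r).mul continuous_const).smul
        ((continuous_circleMap_inv hw).smul (hcont n))
    · refine Eventually.of_forall fun n => Eventually.of_forall fun θ _ => ?_
      rw [norm_smul, norm_smul]
      gcongr
      exact hC n _ (hsph θ)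
    · refine Continuous.intervalIntegrable ?_ _ _
      simp only [deriv_circleMap]
      exact ((continuous_circleMap 0 r).mul continuous_const).norm.mul (hker.mul continuous_const)
    · exact Eventually.of_forall fun θ _ => ((hlim _ (hsph θ)).const_smul _).const_smul _
  have h2 : ∀ n, (2 * (Real.pi : ℂ) * Complex.I)⁻¹ • (∮ ζ in C(c, r), (ζ - w)⁻¹ • f n ζ) = f n w :=
    fun n => ((hf n).mono hrΩ).diffContOnCl_ball
      (subset_refl _) |>.two_pi_i_inv_smul_circleIntegral_sub_inv_smul hw
  simp only [h2] at h1
  exact tendsto_nhds_unique h1 (hlim w (hrΩ (ball_subset_closedBall hw)))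

open MeasureTheory Metric in
/-- A bounded function is holomorphic as soon as its compositions with a norming family of
contractions are. By the Schwarz lemma these compositions are equi-Lipschitz near each point, so the
function itself is continuous; its Cauchy integral then exists, and the family identifies it with
the function. -/
theorem differentiableOn_of_norming {E G ι : Type*} [NormedAddCommGroup E] [NormedSpace ℂ E]
    [CompleteSpace E] [NormedAddCommGroup G] [NormedSpace ℂ G] [CompleteSpace G]
    {Ω : Set ℂ} (hΩ : IsOpen Ω) (ℓ : ι → E →L[ℂ] G) (hℓ : ∀ i e, ‖ℓ i e‖ ≤ ‖e‖)
    (hnorm : ∀ e (C : ℝ), 0 ≤ C → (∀ i, ‖ℓ i e‖ ≤ C) → ‖e‖ ≤ C) {F : ℂ → E} {C : ℝ}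
    (hC : ∀ z ∈ Ω, ‖F z‖ ≤ C) (hF : ∀ i, DifferentiableOn ℂ (fun z => ℓ i (F z)) Ω) :
    DifferentiableOn ℂ F Ω := by
  have hcont : ContinuousOn F Ω := by
    intro c hc
    obtain ⟨r, hr, hrΩ⟩ := Metric.isOpen_iff.1 hΩ c hc
    have hC0 : 0 ≤ C := (norm_nonneg _).trans (hC c hc)
    have key : ∀ z ∈ ball c r, ‖F z - F c‖ ≤ 2 * C / r * dist z c := fun z hz => by
      refine hnorm _ _ (by positivity) fun i => ?_
      rw [map_sub, ← dist_eq_norm]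
      refine Complex.dist_le_div_mul_dist_of_mapsTo_ball ((hF i).mono hrΩ) (fun y hy => ?_) hz
      rw [mem_closedBall, dist_eq_norm, ← map_sub]
      refine (hℓ i _).trans ((norm_sub_le _ _).trans ?_)
      linarith [hC y (hrΩ hy), hC c hc]
    refine ContinuousAt.continuousWithinAt (tendsto_iff_norm_sub_tendsto_zero.2 ?_)
    refine squeeze_zero' (Eventually.of_forall fun _ => norm_nonneg _)
      (eventually_of_mem (ball_mem_nhds c hr) key) ?_
    have : Continuous fun z => 2 * C / r * dist z c := by fun_prop
    simpa using this.tendsto c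
  intro c hc
  obtain ⟨r, hr, hrΩ⟩ := nhds_basis_closedBall.mem_iff.1 (hΩ.mem_nhds hc)
  have hcF : Continuous fun θ => F (circleMap c r θ) :=
    hcont.comp_continuous (continuous_circleMap c r) fun θ =>
      hrΩ (circleMap_mem_closedBall c hr.le θ)
  refine ((differentiableOn_ball_of_eq_cauchyIntegral hr (hcF.intervalIntegrable _ _)
    fun w hw => ?_).differentiableAt (ball_mem_nhds c hr)).differentiableWithinAt
  rw [← sub_eq_zero, ← norm_le_zero_iff]
  refine hnorm _ 0 le_rfl fun i => ?_
  rw [norm_le_zero_iff, map_sub, sub_eq_zero, map_smul]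
  have hint : IntervalIntegrable (fun θ => deriv (circleMap c r) θ •
      ((circleMap c r θ - w)⁻¹ • F (circleMap c r θ))) volume 0 (2 * Real.pi) := by
    refine Continuous.intervalIntegrable ?_ _ _
    simp only [deriv_circleMap]
    exact ((continuous_circleMap 0 r).mul continuous_const).smul
      ((continuous_circleMap_inv hw).smul hcF)
  have h := ((hF i).mono hrΩ).diffContOnCl_ball
      (subset_refl _) |>.two_pi_i_inv_smul_circleIntegral_sub_inv_smul hw
  rw [← h, circleIntegral, ← (ℓ i).intervalIntegral_comp_comm hint]
  simp only [circleIntegral, map_smul]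

/-! ### The Laplace transform of a semigroup -/

namespace C0Semigroup

open MeasureTheory Set

variable {X : Type*} [NormedAddCommGroup X] [NormedSpace ℂ X]

/-- The orbit `s ↦ T(s)x`, extended to `s < 0` by the constant value `x`. -/
noncomputable def orbit (T : C0Semigroup X) (x : X) (s : ℝ) : X := T s.toNNReal x

theorem continuous_orbit (T : C0Semigroup X) (x : X) : Continuous (T.orbit x) :=
  (T.strongCont x).comp continuous_real_toNNReal

theorem orbit_coe (T : C0Semigroup X) (x : X) (t : ℝ≥0) : T.orbit x t = T t x := by
  simp [orbit]

theorem orbit_zero (T : C0Semigroup X) (x : X) : T.orbit x 0 = x := by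
  simp [orbit, T.map_zero]

theorem apply_orbit (T : C0Semigroup X) (x : X) (h : ℝ≥0) {s : ℝ} (hs : 0 ≤ s) :
    T h (T.orbit x s) = T.orbit x (s + h) := by
  rw [orbit, orbit, Real.toNNReal_add hs h.coe_nonneg, Real.toNNReal_coe, add_comm, T.map_add,
    ContinuousLinearMap.comp_apply]

theorem orbit_apply (T : C0Semigroup X) (x : X) (h : ℝ≥0) (s : ℝ) :
    T.orbit (T h x) s = T h (T.orbit x s) := by
  rw [orbit, orbit, ← ContinuousLinearMap.comp_apply, ← T.map_add, add_comm, T.map_add,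
    ContinuousLinearMap.comp_apply]

variable {T : C0Semigroup X} {M ω μ : ℝ}

theorem norm_orbit_le (hb : ∀ t : ℝ≥0, ‖T t‖ ≤ M * Real.exp (ω * t)) (x : X) {s : ℝ}
    (hs : 0 ≤ s) : ‖T.orbit x s‖ ≤ M * Real.exp (ω * s) * ‖x‖ := by
  have h := hb s.toNNReal
  rw [Real.coe_toNNReal s hs] at h
  exact ((T _).le_opNorm x).trans (by gcongr)

theorem norm_exp_smul_orbit_le (hb : ∀ t : ℝ≥0, ‖T t‖ ≤ M * Real.exp (ω * t)) (x : X) {s : ℝ}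
    (hs : 0 ≤ s) :
    ‖Real.exp (-μ * s) • T.orbit x s‖ ≤ Real.exp (-(μ - ω) * s) * (M * ‖x‖) := by
  rw [norm_smul, Real.norm_of_nonneg (Real.exp_pos _).le]
  calc _ ≤ Real.exp (-μ * s) * (M * Real.exp (ω * s) * ‖x‖) := by
        gcongr; exact norm_orbit_le hb x hs
    _ = (Real.exp (-μ * s) * Real.exp (ω * s)) * (M * ‖x‖) := by ring
    _ = _ := by rw [← Real.exp_add]; ring_nf

theorem integrableOn_exp_smul_orbit (hb : ∀ t : ℝ≥0, ‖T t‖ ≤ M * Real.exp (ω * t)) (hμ : ω < μ)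
    (x : X) : IntegrableOn (fun s => Real.exp (-μ * s) • T.orbit x s) (Ioi 0) := by
  refine Integrable.mono' ((integrableOn_exp_mul_Ioi (a := -(μ - ω)) (by linarith) 0).mul_const
    (M * ‖x‖)) ?_ ?_
  · have := T.continuous_orbit x
    exact Continuous.aestronglyMeasurable (by fun_prop)
  · exact ae_restrict_of_forall_mem measurableSet_Ioi fun s hs =>
      norm_exp_smul_orbit_le hb x (le_of_lt hs)

/-- The Laplace transform `∫₀^∞ exp(-μ s) T(s)x ds` of the orbit of `x`. -/
noncomputable def laplace (T : C0Semigroup X) (μ : ℝ) (x : X) : X :=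
  ∫ s in Ioi (0 : ℝ), Real.exp (-μ * s) • T.orbit x s

/-- The Laplace transform of an exponentially bounded semigroup, as a bounded operator. -/
noncomputable def laplaceCLM (hb : ∀ t : ℝ≥0, ‖T t‖ ≤ M * Real.exp (ω * t)) (hμ : ω < μ) :
    X →L[ℂ] X :=
  LinearMap.mkContinuous
    { toFun := T.laplace μ
      map_add' := fun x y => by
        rw [laplace, laplace, laplace, ← integral_add (integrableOn_exp_smul_orbit hb hμ x)
          (integrableOn_exp_smul_orbit hb hμ y)]
        simp only [orbit, _root_.map_add, smul_add]
      map_smul' := fun c x => by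
        rw [laplace, laplace, ← integral_smul]
        simp only [orbit, map_smul, RingHom.id_apply]
        congr 1
        funext s
        exact smul_comm _ _ _ }
    ((∫ s in Ioi (0 : ℝ), Real.exp (-(μ - ω) * s)) * M) fun x => by
      rw [mul_assoc, ← integral_mul_const]
      exact norm_integral_le_of_norm_le
        ((integrableOn_exp_mul_Ioi (a := -(μ - ω)) (by linarith) 0).mul_const _)
        (ae_restrict_of_forall_mem measurableSet_Ioi fun s hs =>
          norm_exp_smul_orbit_le hb x (le_of_lt hs))

theorem laplaceCLM_apply (hb : ∀ t : ℝ≥0, ‖T t‖ ≤ M * Real.exp (ω * t)) (hμ : ω < μ) (x : X) :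
    laplaceCLM hb hμ x = T.laplace μ x := rfl

theorem generator_apply_eq {x y : X} (h : T.HasGeneratorValue x y) (hx : x ∈ T.generator.domain) :
    T.generator ⟨x, hx⟩ = y :=
  HasGeneratorValue.unique (Classical.choose_spec hx) h

variable [CompleteSpace X]

theorem laplaceCLM_comm (hb : ∀ t : ℝ≥0, ‖T t‖ ≤ M * Real.exp (ω * t)) (hμ : ω < μ) (h : ℝ≥0)
    (x : X) : laplaceCLM hb hμ (T h x) = T h (laplaceCLM hb hμ x) := by
  simp only [laplaceCLM_apply, laplace]
  rw [← (T h).integral_comp_comm (integrableOn_exp_smul_orbit hb hμ x)]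
  refine setIntegral_congr_fun measurableSet_Ioi fun s _ => ?_
  simp only [orbit_apply T x h s]
  rw [(T h).map_smul_of_tower]

/-- The semigroup acts on a Laplace transform by translating the integration variable. -/
theorem apply_laplace (hb : ∀ t : ℝ≥0, ‖T t‖ ≤ M * Real.exp (ω * t)) (hμ : ω < μ) (h : ℝ≥0)
    (x : X) : T h (T.laplace μ x) =
      Real.exp (μ * h) • (T.laplace μ x - ∫ s in (0 : ℝ)..h, Real.exp (-μ * s) • T.orbit x s) := by
  have hint := integrableOn_exp_smul_orbit hb hμ x
  have e1 : T h (T.laplace μ x) =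
      ∫ s in Ioi (0 : ℝ), Real.exp (-μ * s) • T.orbit x (s + h) := by
    rw [laplace, ← (T h).integral_comp_comm hint]
    refine setIntegral_congr_fun measurableSet_Ioi fun s hs => ?_
    simp only [← apply_orbit T x h (le_of_lt hs)]
    rw [(T h).map_smul_of_tower]
  have e2 : (∫ s in Ioi (0 : ℝ), Real.exp (-μ * s) • T.orbit x (s + h)) =
      Real.exp (μ * h) • ∫ s in Ioi (h : ℝ), Real.exp (-μ * s) • T.orbit x s := by
    rw [← integral_smul]
    have := (measurePreserving_add_right volume (h : ℝ)).setIntegral_preimage_emb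
      (MeasurableEquiv.addRight (h : ℝ)).measurableEmbedding
      (fun s => Real.exp (μ * h) • Real.exp (-μ * s) • T.orbit x s) (Ioi (h : ℝ))
    rw [← this]
    have hs : (fun s : ℝ => s + h) ⁻¹' Ioi (h : ℝ) = Ioi 0 := by ext; simp
    rw [hs]
    congr 1
    funext s
    rw [smul_smul, ← Real.exp_add]
    congr 2
    ring
  have h0 : (0 : ℝ) ≤ h := h.coe_nonneg
  rw [e1, e2, intervalIntegral.integral_of_le h0, laplace,
    ← Ioc_union_Ioi_eq_Ioi h0, setIntegral_union (Ioc_disjoint_Ioi le_rfl) measurableSet_Ioi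
      (hint.mono_set Ioc_subset_Ioi_self) (hint.mono_set (Ioi_subset_Ioi h0)), add_sub_cancel_left]

/-- The generator sends the Laplace transform `R x` of the orbit of `x` to `μ R x - x`: the value is
the derivative at `h = 0` of the right-hand side of `apply_laplace`. -/
theorem hasGeneratorValue_laplace (hb : ∀ t : ℝ≥0, ‖T t‖ ≤ M * Real.exp (ω * t)) (hμ : ω < μ)
    (x : X) : T.HasGeneratorValue (T.laplace μ x) (μ • T.laplace μ x - x) := by
  set φ : ℝ → X := fun h => Real.exp (μ * h) •
    (T.laplace μ x - ∫ s in (0 : ℝ)..h, Real.exp (-μ * s) • T.orbit x s) with hφ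
  have hc : Continuous fun s => Real.exp (-μ * s) • T.orbit x s := by
    have := T.continuous_orbit x
    fun_prop
  have hd : HasDerivAt φ (μ • T.laplace μ x - x) 0 := by
    have h1 : HasDerivAt (fun h : ℝ => Real.exp (μ * h)) μ 0 := by
      simpa using ((hasDerivAt_id (0 : ℝ)).const_mul μ).exp
    have h2 := intervalIntegral.integral_hasDerivAt_right (hc.intervalIntegrable (0 : ℝ) 0)
      hc.aestronglyMeasurable.stronglyMeasurableAtFilter hc.continuousAt
    have h3 := h1.smul (h2.const_sub (T.laplace μ x))
    refine h3.congr_deriv ?_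
    simp [orbit_zero]
    abel
  have hlim := hd.tendsto_slope_zero_right
  have hcoe : Tendsto ((↑) : ℝ≥0 → ℝ) (𝓝[>] 0) (𝓝[>] 0) := by
    refine tendsto_nhdsWithin_iff.2 ⟨?_, ?_⟩
    · exact (NNReal.continuous_coe.tendsto' 0 0 rfl).mono_left nhdsWithin_le_nhds
    · exact eventually_mem_nhdsWithin.mono fun t ht => NNReal.coe_pos.2 ht
  refine (hlim.comp hcoe).congr fun t => ?_
  have h0 : φ 0 = T.laplace μ x := by simp [hφ]
  simp only [Function.comp, zero_add, h0, diffQuot, apply_laplace hb hμ]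
  rw [← Complex.ofReal_inv, Complex.coe_smul]

/-- The Laplace transform of the semigroup is the resolvent of its generator. -/
theorem isResolvent_laplaceCLM (hb : ∀ t : ℝ≥0, ‖T t‖ ≤ M * Real.exp (ω * t)) (hμ : ω < μ) :
    T.generator.IsResolvent (μ : ℂ) (laplaceCLM hb hμ) := by
  refine ⟨fun y => ?_, fun ⟨x, y, hxy⟩ => ?_⟩
  · have h : T.HasGeneratorValue (laplaceCLM hb hμ y) (μ • laplaceCLM hb hμ y - y) :=
      hasGeneratorValue_laplace hb hμ y
    have hmem : laplaceCLM hb hμ y ∈ T.generator.domain := ⟨_, h⟩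
    refine ⟨hmem, ?_⟩
    rw [generator_apply_eq h hmem]
    simp
  · have hmem : x ∈ T.generator.domain := ⟨y, hxy⟩
    change laplaceCLM hb hμ ((μ : ℂ) • x - T.generator ⟨x, hmem⟩) = x
    rw [generator_apply_eq hxy hmem, map_sub, map_smul]
    -- `R` commutes with the semigroup, so `R A x` is the generator value at `R x`.
    have h1 : T.HasGeneratorValue (laplaceCLM hb hμ x) (laplaceCLM hb hμ y) := by
      refine (((laplaceCLM hb hμ).continuous.tendsto y).comp hxy).congr fun t => ?_
      simp only [Function.comp, diffQuot, map_smul, map_sub, laplaceCLM_comm]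
    rw [h1.unique (hasGeneratorValue_laplace hb hμ x)]
    simp [laplaceCLM_apply]

end C0Semigroup

/-! ### Resolvents depending on a parameter -/

namespace LinearPMap

variable {X : Type*} [NormedAddCommGroup X] [NormedSpace ℂ X]

theorem IsResolvent.resolventOp_eq {A : X →ₗ.[ℂ] X} {μ : ℂ} {R : X →L[ℂ] X}
    (h : A.IsResolvent μ R) : A.resolventOp μ = R := by
  have hex : ∃ R, A.IsResolvent μ R := ⟨R, h⟩
  rw [resolventOp, dif_pos hex]
  exact (Classical.choose_spec hex).unique h

/-- The resolvent identity `R_μ - R_ν = (ν - μ) R_μ R_ν`. -/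
theorem IsResolvent.sub_eq {A : X →ₗ.[ℂ] X} {μ ν : ℂ} {R S : X →L[ℂ] X}
    (hR : A.IsResolvent μ R) (hS : A.IsResolvent ν S) : R - S = (ν - μ) • (R * S) := by
  ext y
  obtain ⟨hy, e⟩ := hS.1 y
  have h : R (μ • S y - A ⟨S y, hy⟩) = S y := hR.2 ⟨S y, hy⟩
  have e' : μ • S y - A ⟨S y, hy⟩ = y - (ν - μ) • S y := by
    linear_combination (norm := module) (1 : ℂ) • e
  rw [e', _root_.map_sub, _root_.map_smul] at h
  change R y - S y = (ν - μ) • R (S y)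
  rw [sub_eq_iff_eq_add, ← sub_eq_iff_eq_add']
  exact h

/-- If the resolvents at one point depend holomorphically on a parameter, so do the resolvents at
any other point of the resolvent sets, because `R_ν = (1 + (ν - μ) R_μ)⁻¹ R_μ`. -/
theorem differentiableOn_of_isResolvent [CompleteSpace X] {Ω : Set ℂ} {A : ℂ → X →ₗ.[ℂ] X}
    {μ ν : ℂ} {R S : ℂ → X →L[ℂ] X} (hR : ∀ z ∈ Ω, (A z).IsResolvent μ (R z))
    (hS : ∀ z ∈ Ω, (A z).IsResolvent ν (S z)) (hd : DifferentiableOn ℂ R Ω) :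
    DifferentiableOn ℂ S Ω := by
  have hl : ∀ z ∈ Ω, (1 + (ν - μ) • R z) * (1 + (μ - ν) • S z) = 1 := fun z hz => by
    have h := (hR z hz).sub_eq (hS z hz)
    simp only [add_mul, mul_add, one_mul, mul_one, smul_mul_assoc, mul_smul_comm]
    rw [← h]
    module
  have hr : ∀ z ∈ Ω, (1 + (μ - ν) • S z) * (1 + (ν - μ) • R z) = 1 := fun z hz => by
    have h := (hS z hz).sub_eq (hR z hz)
    simp only [add_mul, mul_add, one_mul, mul_one, smul_mul_assoc, mul_smul_comm]
    rw [← h]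
    module
  have hS' : ∀ z ∈ Ω, S z = Ring.inverse (1 + (ν - μ) • R z) * R z := fun z hz => by
    let u : (X →L[ℂ] X)ˣ := ⟨_, _, hl z hz, hr z hz⟩
    have hu : Ring.inverse (1 + (ν - μ) • R z) = 1 + (μ - ν) • S z := Ring.inverse_unit u
    have h := (hS z hz).sub_eq (hR z hz)
    rw [hu, add_mul, one_mul, smul_mul_assoc, ← h]
    abel
  refine DifferentiableOn.congr (fun z hz => ?_) hS'
  have hu : IsUnit (1 + (ν - μ) • R z) := ⟨⟨_, _, hl z hz, hr z hz⟩, rfl⟩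
  exact ((differentiableAt_inverse (𝕜 := ℂ) hu).comp_differentiableWithinAt z
    (((hd z hz).const_smul (ν - μ)).const_add 1)).mul (hd z hz)

end LinearPMap

/-! ### Inversion of the Laplace transform by polynomial kernels -/

namespace C0Semigroup

open MeasureTheory Set Polynomial

variable {X : Type*} [NormedAddCommGroup X] [NormedSpace ℂ X]
  {T : C0Semigroup X} {M ω : ℝ}

/-- The substitution `v = exp(-s)` turns Laplace transforms into moments over `[0,1]`. -/
theorem integral_pow_smul_orbit_neg_log (T : C0Semigroup X) (x : X) (j : ℕ) :
    ∫ v in Icc (0 : ℝ) 1, v ^ j • T.orbit x (-Real.log v) = T.laplace (j + 1) x := by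
  have himg : (fun s : ℝ => Real.exp (-s)) '' Ioi 0 = Ioo 0 1 := by
    ext v
    constructor
    · rintro ⟨s, hs, rfl⟩
      exact ⟨Real.exp_pos _, Real.exp_lt_one_iff.2 (neg_neg_of_pos hs)⟩
    · rintro ⟨h0, h1⟩
      exact ⟨-Real.log v, neg_pos.2 (Real.log_neg h0 h1), by simp [Real.exp_log h0]⟩
  rw [integral_Icc_eq_integral_Ioo, ← himg,
    integral_image_eq_integral_abs_deriv_smul measurableSet_Ioi
      (f' := fun s => Real.exp (-s) * (-1))
      (fun s _ => ((hasDerivAt_neg s).exp).hasDerivWithinAt)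
      (fun s _ t _ h => neg_injective (Real.exp_injective h)), laplace]
  refine setIntegral_congr_fun measurableSet_Ioi fun s _ => ?_
  simp only [mul_neg, mul_one, abs_neg, Real.abs_exp, Real.log_exp, neg_neg]
  rw [smul_smul, ← Real.exp_nat_mul, ← Real.exp_add]
  congr 2
  ring

/-- For `N ≥ ω`, the weight `v ^ N` compensates the growth of the orbit in the variable
`v = exp(-s)`. -/
theorem norm_pow_smul_orbit_neg_log_le (hb : ∀ t : ℝ≥0, ‖T t‖ ≤ M * Real.exp (ω * t)) {N : ℕ}
    (hN : ω ≤ N) (x : X) {v : ℝ} (hv : v ∈ Icc (0 : ℝ) 1) :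
    ‖v ^ N • T.orbit x (-Real.log v)‖ ≤ M * ‖x‖ := by
  have hM : 0 ≤ M := by
    simpa using (norm_nonneg _).trans (hb 0)
  have hlog : Real.log v ≤ 0 := Real.log_nonpos hv.1 hv.2
  have h := norm_orbit_le hb x (neg_nonneg.2 hlog)
  rw [norm_smul, Real.norm_of_nonneg (pow_nonneg hv.1 N)]
  have key : v ^ N * Real.exp (ω * -Real.log v) ≤ 1 := by
    rcases hv.1.eq_or_lt with h0 | h0
    · subst h0
      simpa using pow_le_one₀ le_rfl zero_le_one
    · rw [← Real.exp_log (pow_pos h0 N), ← Real.exp_add, Real.log_pow, Real.exp_le_one_iff]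
      nlinarith
  calc _ ≤ v ^ N * (M * Real.exp (ω * -Real.log v) * ‖x‖) :=
        mul_le_mul_of_nonneg_left h (pow_nonneg hv.1 N)
    _ = (v ^ N * Real.exp (ω * -Real.log v)) * (M * ‖x‖) := by ring
    _ ≤ 1 * (M * ‖x‖) := by gcongr
    _ = _ := one_mul _

theorem integrableOn_pow_smul_orbit_neg_log (hb : ∀ t : ℝ≥0, ‖T t‖ ≤ M * Real.exp (ω * t))
    {N : ℕ} (hN : ω ≤ N) (x : X) :
    IntegrableOn (fun v : ℝ => v ^ N • T.orbit x (-Real.log v)) (Icc 0 1) := by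
  have hmeas : StronglyMeasurable fun v : ℝ => v ^ N • T.orbit x (-Real.log v) :=
    (continuous_pow N).stronglyMeasurable.smul
      ((T.continuous_orbit x).stronglyMeasurable.comp_measurable Real.measurable_log.neg)
  exact Measure.integrableOn_of_bounded (by simp) hmeas.aestronglyMeasurable
    (ae_restrict_of_forall_mem measurableSet_Icc fun v hv =>
      norm_pow_smul_orbit_neg_log_le hb hN x hv)

theorem integral_eval_smul_orbit_neg_log (hb : ∀ t : ℝ≥0, ‖T t‖ ≤ M * Real.exp (ω * t)) {N : ℕ}
    (hN : ω ≤ N) (p : ℝ[X]) (x : X) :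
    ∫ v in Icc (0 : ℝ) 1, p.eval v • v ^ N • T.orbit x (-Real.log v) =
      ∑ i ∈ Finset.range (p.natDegree + 1), p.coeff i • T.laplace ((N + i : ℕ) + 1) x := by
  have hi : ∀ i : ℕ, ω ≤ (N + i : ℕ) := fun i => by
    push_cast
    linarith [i.cast_nonneg (α := ℝ)]
  simp only [← integral_pow_smul_orbit_neg_log, ← integral_smul]
  have hint : ∀ i ∈ Finset.range (p.natDegree + 1),
      IntegrableOn (fun v : ℝ => p.coeff i • v ^ (N + i) • T.orbit x (-Real.log v)) (Icc 0 1) :=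
    fun i _ => (integrableOn_pow_smul_orbit_neg_log hb (hi i) x).smul (p.coeff i)
  rw [← integral_finsetSum _ hint]
  congr 1
  funext v
  rw [eval_eq_sum_range, Finset.sum_smul]
  refine Finset.sum_congr rfl fun i _ => ?_
  rw [smul_smul, smul_smul, mul_assoc, ← pow_add, add_comm i N]

/-- The Landau kernel of order `n` at `a`, before normalization. -/
noncomputable def landau (a : ℝ) (n : ℕ) : ℝ[X] := (1 - (Polynomial.X - C a) ^ 2) ^ n

theorem eval_landau (a : ℝ) (n : ℕ) (v : ℝ) : (landau a n).eval v = (1 - (v - a) ^ 2) ^ n := by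
  simp [landau]

/-- The mean of the weighted orbit `v ↦ v ^ N • T(-log v)x` over `[0,1]` against the normalized
Landau kernel at `a`. -/
noncomputable def landauMean (T : C0Semigroup X) (N : ℕ) (a : ℝ) (n : ℕ) (x : X) : X :=
  (∫ v in Icc (0 : ℝ) 1, (1 - (v - a) ^ 2) ^ n)⁻¹ •
    ∫ v in Icc (0 : ℝ) 1, (1 - (v - a) ^ 2) ^ n • v ^ N • T.orbit x (-Real.log v)

theorem landauMean_eq_sum (hb : ∀ t : ℝ≥0, ‖T t‖ ≤ M * Real.exp (ω * t)) {N : ℕ} (hN : ω ≤ N)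
    (a : ℝ) (n : ℕ) (x : X) :
    T.landauMean N a n x = (∫ v in Icc (0 : ℝ) 1, (1 - (v - a) ^ 2) ^ n)⁻¹ •
      ∑ i ∈ Finset.range ((landau a n).natDegree + 1),
        (landau a n).coeff i • T.laplace ((N + i : ℕ) + 1) x := by
  rw [← integral_eval_smul_orbit_neg_log hb hN, landauMean]
  simp only [eval_landau]

theorem norm_landauMean_le (hb : ∀ t : ℝ≥0, ‖T t‖ ≤ M * Real.exp (ω * t)) {N : ℕ} (hN : ω ≤ N)
    {a : ℝ} (ha : a ∈ Icc (0 : ℝ) 1) (n : ℕ) (x : X) : ‖T.landauMean N a n x‖ ≤ M * ‖x‖ := by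
  have hM : 0 ≤ M := by
    simpa using (norm_nonneg _).trans (hb 0)
  have hc : ∀ v ∈ Icc (0 : ℝ) 1, 0 ≤ (1 - (v - a) ^ 2) ^ n := fun v hv =>
    pow_nonneg (by nlinarith [hv.1, hv.2, ha.1, ha.2]) n
  have hI : 0 ≤ ∫ v in Icc (0 : ℝ) 1, (1 - (v - a) ^ 2) ^ n :=
    setIntegral_nonneg measurableSet_Icc hc
  have hint : IntegrableOn (fun v : ℝ => (1 - (v - a) ^ 2) ^ n) (Icc 0 1) :=
    (by fun_prop : Continuous fun v : ℝ => (1 - (v - a) ^ 2) ^ n).integrableOn_Icc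
  have hle : ‖∫ v in Icc (0 : ℝ) 1, (1 - (v - a) ^ 2) ^ n • v ^ N • T.orbit x (-Real.log v)‖ ≤
      (∫ v in Icc (0 : ℝ) 1, (1 - (v - a) ^ 2) ^ n) * (M * ‖x‖) := by
    rw [← integral_mul_const]
    refine norm_integral_le_of_norm_le (hint.mul_const _)
      (ae_restrict_of_forall_mem measurableSet_Icc fun v hv => ?_)
    rw [norm_smul, Real.norm_of_nonneg (hc v hv)]
    exact mul_le_mul_of_nonneg_left (norm_pow_smul_orbit_neg_log_le hb hN x hv) (hc v hv)
  rw [landauMean, norm_smul, norm_inv, Real.norm_of_nonneg hI]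
  exact inv_mul_le_of_le_mul₀ hI (by positivity) hle

theorem tendsto_landauMean [CompleteSpace X] (hb : ∀ t : ℝ≥0, ‖T t‖ ≤ M * Real.exp (ω * t))
    {N : ℕ} (hN : ω ≤ N) {a : ℝ} (ha : a ∈ Ioc (0 : ℝ) 1) (x : X) :
    Tendsto (fun n => T.landauMean N a n x) atTop (𝓝 (a ^ N • T.orbit x (-Real.log a))) := by
  refine tendsto_setIntegral_pow_smul_of_unique_maximum_of_isCompact_of_integrableOn
    (g := fun v : ℝ => v ^ N • T.orbit x (-Real.log v)) (c := fun v => 1 - (v - a) ^ 2) isCompact_Icc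
    (by fun_prop) (fun v _ hva => ?_) (fun v hv => ?_) (by simp) ?_
    (integrableOn_pow_smul_orbit_neg_log hb hN x) ?_
  · have : 0 < (v - a) ^ 2 := by
      have := sub_ne_zero.2 hva
      positivity
    simpa using this
  · nlinarith [hv.1, hv.2, ha.1, ha.2]
  · rw [interior_Icc, closure_Ioo zero_ne_one]
    exact ⟨ha.1.le, ha.2⟩
  · exact ((continuous_pow N).continuousAt.smul ((T.continuous_orbit x).continuousAt.comp
      (Real.continuousAt_log ha.1.ne').neg)).continuousWithinAt

end C0Semigroup

/-! ### Holomorphic dependence of semigroups on a parameter -/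

theorem theorem3p1 {X : Type*} [NormedAddCommGroup X] [NormedSpace ℂ X] [CompleteSpace X]
    (Ω : Set ℂ) (hΩ : IsOpen Ω) (T : ℂ → C0Semigroup X) (ω : ℝ)
    (hM : BddAbove {r : ℝ | ∃ t : ℝ≥0, ∃ z ∈ Ω, r = Real.exp (-ω * t) * ‖T z t‖})
    (lam : ℝ) (hlam : ω < lam)
    (hhol : DifferentiableOn ℂ (fun z => (T z).generator.resolventOp (lam : ℂ)) Ω) :
    (∀ t₁ : ℝ, 0 < t₁ → ∀ x : X,
      DifferentiableOn ℂ (fun z => (T z).orbitOn x t₁) Ω) ∧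
    (∀ t : ℝ≥0, DifferentiableOn ℂ (fun z => T z t) Ω) := by
  obtain ⟨M, hM⟩ := hM
  have hb : ∀ z ∈ Ω, ∀ t : ℝ≥0, ‖T z t‖ ≤ M * Real.exp (ω * t) := fun z hz t => by
    have h := hM ⟨t, z, hz, rfl⟩
    rwa [neg_mul, Real.exp_neg, inv_mul_le_iff₀ (Real.exp_pos _), mul_comm] at h
  have hlap : ∀ μ : ℝ, ω < μ → ∀ x, DifferentiableOn ℂ (fun z => (T z).laplace μ x) Ω := by
    intro μ hμ x
    have hres : ∀ ν : ℝ, ω < ν → ∀ z ∈ Ω,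
        (T z).generator.IsResolvent (ν : ℂ) ((T z).generator.resolventOp (ν : ℂ)) := by
      intro ν hν z hz
      have h := C0Semigroup.isResolvent_laplaceCLM (hb z hz) hν
      rwa [h.resolventOp_eq]
    have hd := LinearPMap.differentiableOn_of_isResolvent (hres lam hlam) (hres μ hμ) hhol
    refine (hd.clm_apply (differentiableOn_const x)).congr fun z hz => ?_
    rw [(C0Semigroup.isResolvent_laplaceCLM (hb z hz) hμ).resolventOp_eq]
    rfl
  -- Holomorphy of single values; the factor `a ^ N` produced by the weight is divided out at the end.
  have hpt : ∀ (t : ℝ≥0) (x : X), DifferentiableOn ℂ (fun z => T z t x) Ω := by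
    intro t x
    obtain ⟨N, hN⟩ := exists_nat_ge ω
    set a := Real.exp (-(t : ℝ)) with ha_def
    have ha : a ∈ Set.Ioc (0 : ℝ) 1 := ⟨Real.exp_pos _, by simp [ha_def]⟩
    have hmean : DifferentiableOn ℂ
        (fun z => a ^ N • (T z).orbit x (-Real.log a)) Ω := by
      refine differentiableOn_of_tendsto_of_bounded hΩ
        (f := fun n z => (T z).landauMean N a n x) (C := M * ‖x‖) (fun n => ?_)
        (fun n z hz => C0Semigroup.norm_landauMean_le (hb z hz) hN ⟨ha.1.le, ha.2⟩ n x)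
        (fun z hz => C0Semigroup.tendsto_landauMean (hb z hz) hN ha x)
      refine DifferentiableOn.congr (DifferentiableOn.const_smul
        (DifferentiableOn.fun_sum fun i _ => (hlap _ ?_ x).const_smul _) _)
        fun z hz => C0Semigroup.landauMean_eq_sum (hb z hz) hN a n x
      push_cast
      linarith [i.cast_nonneg (α := ℝ)]
    refine (hmean.const_smul (a ^ N)⁻¹).congr fun z _ => ?_
    rw [Pi.smul_apply, smul_smul, inv_mul_cancel₀ (pow_pos ha.1 N).ne', one_smul, ha_def,
      Real.log_exp, neg_neg, C0Semigroup.orbit_coe]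
  refine ⟨fun t₁ _ x => ?_, fun t => ?_⟩
  · refine differentiableOn_of_norming hΩ
      (fun s : Set.Icc (0 : ℝ) t₁ => ContinuousMap.evalCLM ℂ s)
      (fun s e => e.norm_coe_le_norm s)
      (fun e C hC h => (ContinuousMap.norm_le e hC).2 h)
      (C := M * Real.exp (|ω| * t₁) * ‖x‖) (fun z hz => ?_) (fun s => hpt _ x)
    have hM0 : 0 ≤ M := by simpa using (norm_nonneg _).trans (hb z hz 0)
    refine (ContinuousMap.norm_le _ (by positivity)).2 fun s => ?_
    refine ((T z _).le_opNorm x).trans ?_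
    gcongr
    refine (hb z hz _).trans ?_
    gcongr
    · exact s.2.1
    · exact le_abs_self ω
    · exact s.2.2
  · refine differentiableOn_of_norming hΩ
      (fun x : Metric.closedBall (0 : X) 1 => ContinuousLinearMap.apply ℂ X (x : X))
      (fun x e => ?_) (fun e C hC h => ?_) (hb · · t) (fun x => hpt t x)
    · refine (e.le_opNorm x).trans (mul_le_of_le_one_right (norm_nonneg e) ?_)
      exact mem_closedBall_zero_iff.1 x.2
    · exact ContinuousLinearMap.opNorm_le_of_unit_norm hC fun x hx => h ⟨x, by simp [hx]⟩
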